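/- There exists a strictly increasing infinite sequence $(t_i)_{i\in\mathbb{N}}$ of positive integers whose set of terms contains no nontrivial $5$-term geometric progression (that is, there are no nonzero real number $a$ and no positive rational number $r\neq 1$ such that all of $a, ar, ar^2, ar^3, ar^4$ are terms of the sequence) such that for every $\varepsilon>0$ there exists a constant $C_\varepsilon>0$ satisfying $$t_{i+1}-t_i<C_\varepsilon\, t_i^{\varepsilon}$$ for all $i\in\mathbb{N}$. -/

import Mathlib

/-- The tuple `a` of nonzero real numbers is a geometric progression of length `k` with
(positive rational) common ratio `r`. -/
def IsGeomProg (k : ℕ) (r : ℚ) (a : Fin k → ℝ) : Prop :=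
  0 < r ∧ (∀ i, a i ≠ 0) ∧
    ∀ i j : Fin k, (j : ℕ) = (i : ℕ) + 1 → a j = (r : ℝ) * a i

/-- A set `S` of natural numbers is `k`-GP-free if it does not contain all the terms of a
nontrivial (that is, with ratio different from `1`) geometric progression of length `k`. -/
def GPFree (k : ℕ) (S : Set ℕ) : Prop :=
  ∀ (r : ℚ) (a : Fin k → ℝ), IsGeomProg k r a → r ≠ 1 → ¬ ∀ i, ∃ n ∈ S, a i = (n : ℝ)

/-! The set is built by the probabilistic method. Over coprime `x < y`, a 5-term progression of
integers is `f x⁴, f x³y, f x²y², f xy³, f y⁴`. Its third term `c` and fourth term `d` share the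
coin `(d, y)`: `c` requires it false, `d` requires it true, so every outcome gives a GP-free set
(`gpFree_selected`).

Selected integers must also be dense in short intervals. In `[N, N + H²)` at least `H` integers have
no square divisor `d²` with `2 ≤ d < H`. They use pairwise disjoint sets of coins, and if `N < H ^
k` each uses at most `4 ^ (k + 3)` of them. All fail with probability exponentially small in `H`, so
a union bound over `k`, `H`, `N` yields one outcome good for all large `H`
(`exists_selected_mem_intervals`). -/

open MeasureTheory ProbabilityTheory in
/-- The law of independent fair coins indexed by `ι`. -/
noncomputable def fairCoins (ι : Type*) : Measure (ι → Bool) :=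
  Measure.infinitePi fun _ => uniformOn Set.univ

/-! ### Independent requirements on fair coins. -/

section FairCoins

open MeasureTheory ProbabilityTheory

variable {ι : Type*}

instance isProbabilityMeasure_uniformOn_bool :
    IsProbabilityMeasure (uniformOn (Set.univ : Set Bool)) :=
  isProbabilityMeasure_uniformOn Set.finite_univ Set.univ_nonempty

instance isProbabilityMeasure_fairCoins : IsProbabilityMeasure (fairCoins ι) := by
  unfold fairCoins
  infer_instance

theorem measurableSet_agree (A : Finset ι) (τ : ι → Bool) :
    MeasurableSet {ω : ι → Bool | ∀ i ∈ A, ω i = τ i} := by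
  have : {ω : ι → Bool | ∀ i ∈ A, ω i = τ i} = Set.pi A fun i => {τ i} := by
    ext; simp
  rw [this]
  exact MeasurableSet.pi A.countable_toSet fun i _ => measurableSet_singleton _

theorem fairCoins_agree (A : Finset ι) (τ : ι → Bool) :
    fairCoins ι {ω | ∀ i ∈ A, ω i = τ i} = 2⁻¹ ^ A.card := by
  have : {ω : ι → Bool | ∀ i ∈ A, ω i = τ i} = Set.pi A fun i => {τ i} := by
    ext; simp
  rw [this, fairCoins, Measure.infinitePi_pi _ fun i _ => measurableSet_singleton _]
  have hcoin : ∀ b : Bool, uniformOn (Set.univ : Set Bool) {b} = 2⁻¹ := fun b => by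
    rw [uniformOn_univ, Measure.count_singleton, Fintype.card_bool, Nat.cast_ofNat, one_div]
  simp_rw [hcoin, Finset.prod_const]

theorem fairCoins_not_agree_le (A : Finset ι) (τ : ι → Bool) {D : ℕ} (hA : A.card ≤ D) :
    fairCoins ι {ω | ¬ ∀ i ∈ A, ω i = τ i} ≤ 1 - 2⁻¹ ^ D := by
  have h := prob_compl_eq_one_sub (μ := fairCoins ι) (measurableSet_agree A τ)
  rw [fairCoins_agree] at h
  refine h.le.trans (tsub_le_tsub_left ?_ 1)
  exact pow_le_pow_right_of_le_one' (by simp) hA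

/-- Requirements on disjoint coordinate sets are independent, so their failure probabilities
multiply. -/
theorem fairCoins_forall_not_agree_le {κ : Type*} [DecidableEq ι] (S : Finset κ)
    (A : κ → Finset ι) (τ : κ → ι → Bool) {D : ℕ} (hA : ∀ n ∈ S, (A n).card ≤ D)
    (hdisj : (S : Set κ).PairwiseDisjoint A) :
    fairCoins ι {ω | ∀ n ∈ S, ¬ ∀ i ∈ A n, ω i = τ n i} ≤ (1 - 2⁻¹ ^ D) ^ S.card := by
  classical
  induction S using Finset.induction_on with
  | empty => simp
  | insert a S ha ih =>
    have hind : iIndepFun (fun (i : ι) (ω : ι → Bool) => ω i) (fairCoins ι) :=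
      iIndepFun_infinitePi (X := fun _ b => b) fun _ => measurable_id
    have hd : Disjoint (A a) (S.biUnion A) := by
      rw [Finset.disjoint_biUnion_right]
      intro n hn
      exact hdisj (by simp) (by simp [hn]) fun h => ha (h ▸ hn)
    have h := (hind.indepFun_finset (A a) (S.biUnion A) hd
      fun i => measurable_pi_apply i).measure_inter_preimage_eq_mul
        {v | ¬ ∀ i : A a, v i = τ a i}
        {v | ∀ n, ∀ hn : n ∈ S, ¬ ∀ i, ∀ hi : i ∈ A n,
          v ⟨i, Finset.mem_biUnion.2 ⟨n, hn, hi⟩⟩ = τ n i}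
        (Set.toFinite _).measurableSet (Set.toFinite _).measurableSet
    have e : {ω : ι → Bool | ∀ n ∈ insert a S, ¬ ∀ i ∈ A n, ω i = τ n i} =
        {ω | ¬ ∀ i ∈ A a, ω i = τ a i} ∩ {ω | ∀ n ∈ S, ¬ ∀ i ∈ A n, ω i = τ n i} := by
      ext ω
      simp only [Finset.forall_mem_insert, Set.mem_inter_iff, Set.mem_ofPred_eq]
    simp only [Set.preimage_ofPred_eq, Subtype.forall] at h
    rw [e, h, Finset.card_insert_of_notMem ha, pow_succ']
    exact mul_le_mul' (fairCoins_not_agree_le _ _ (hA a (by simp)))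
      (ih (fun n hn => hA n (by simp [hn])) (hdisj.subset (by simp)))

/-- If the failure probabilities of countably many families of independent requirements sum to less
than one, then some assignment meets a requirement from every family. -/
theorem exists_forall_exists_agree {κ J : Type*} [DecidableEq ι] [Countable J]
    (S : J → Finset κ) (A : κ → Finset ι) (τ : κ → ι → Bool) (D m : J → ℕ)
    (hA : ∀ j, ∀ n ∈ S j, (A n).card ≤ D j)
    (hdisj : ∀ j, (S j : Set κ).PairwiseDisjoint A) (hm : ∀ j, m j ≤ (S j).card)
    (hsum : ∑' j, (1 - 2⁻¹ ^ D j : ENNReal) ^ m j < 1) :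
    ∃ ω : ι → Bool, ∀ j, ∃ n ∈ S j, ∀ i ∈ A n, ω i = τ n i := by
  by_contra! hcon
  have huniv : (Set.univ : Set (ι → Bool)) ⊆
      ⋃ j, {ω | ∀ n ∈ S j, ¬ ∀ i ∈ A n, ω i = τ n i} := by
    intro ω _
    obtain ⟨j, hj⟩ := hcon ω
    refine Set.mem_iUnion.2 ⟨j, fun n hn h => ?_⟩
    obtain ⟨i, hi, hne⟩ := hj n hn
    exact hne (h i hi)
  have h1 : (1 : ENNReal) ≤ ∑' j, (1 - 2⁻¹ ^ D j : ENNReal) ^ m j := by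
    calc (1 : ENNReal) = fairCoins ι Set.univ := measure_univ.symm
      _ ≤ _ := measure_mono huniv
      _ ≤ ∑' j, fairCoins ι {ω | ∀ n ∈ S j, ¬ ∀ i ∈ A n, ω i = τ n i} := measure_iUnion_le _
      _ ≤ _ := ENNReal.tsum_le_tsum fun j =>
          (fairCoins_forall_not_agree_le (S j) A τ (hA j) (hdisj j)).trans
            (pow_le_pow_right_of_le_one' tsub_le_self (hm j))
  exact absurd hsum (not_lt.2 h1)

end FairCoins

/-! ### Counting square divisors. -/

/-- The natural numbers whose square divides `n`. -/
def sqDivisors (n : ℕ) : Finset ℕ := n.divisors.filter fun d => d ^ 2 ∣ n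

theorem mem_sqDivisors {n d : ℕ} (hn : n ≠ 0) : d ∈ sqDivisors n ↔ d ^ 2 ∣ n := by
  simp only [sqDivisors, Finset.mem_filter, Nat.mem_divisors]
  exact ⟨fun h => h.2, fun h => ⟨⟨(Dvd.intro_left (d ^ 1) (by ring)).trans h, hn⟩, h⟩⟩

theorem card_sqDivisors_prime_sq_mul_le {p m : ℕ} (hp : p.Prime) (hm : m ≠ 0) :
    (sqDivisors (p ^ 2 * m)).card ≤ 2 * (sqDivisors m).card := by
  have hn : p ^ 2 * m ≠ 0 := mul_ne_zero (pow_ne_zero _ hp.ne_zero) hm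
  have hsub : sqDivisors (p ^ 2 * m) ⊆ sqDivisors m ∪ (sqDivisors m).image (p * ·) := by
    intro d hd
    rw [mem_sqDivisors hn] at hd
    rw [Finset.mem_union, Finset.mem_image, mem_sqDivisors hm]
    by_cases hpd : p ∣ d
    · obtain ⟨e, rfl⟩ := hpd
      refine Or.inr ⟨e, (mem_sqDivisors hm).2 ?_, rfl⟩
      rw [mul_pow] at hd
      exact Nat.dvd_of_mul_dvd_mul_left (pow_pos hp.pos 2) hd
    · left
      have : Nat.Coprime (d ^ 2) (p ^ 2) :=
        Nat.Coprime.pow _ _ ((Nat.coprime_comm.1 ((Nat.Prime.coprime_iff_not_dvd hp).2 hpd)))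
      exact this.dvd_of_dvd_mul_left hd
  calc (sqDivisors (p ^ 2 * m)).card
      ≤ (sqDivisors m ∪ (sqDivisors m).image (p * ·)).card := Finset.card_le_card hsub
    _ ≤ (sqDivisors m).card + ((sqDivisors m).image (p * ·)).card := Finset.card_union_le _ _
    _ ≤ 2 * (sqDivisors m).card := by
      have := Finset.card_image_le (s := sqDivisors m) (f := (p * ·))
      omega

/-- Removing a factor `p ^ 2` shrinks `n` by at least `H` and at most halves the count, so at most
`j` removals occur. -/
theorem card_sqDivisors_le {H j n : ℕ} (hn : n ≠ 0) (hlt : n < H ^ j)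
    (hfree : ∀ d, 1 < d → d ^ 2 ∣ n → H ≤ d) : (sqDivisors n).card ≤ 2 ^ j := by
  induction j generalizing n with
  | zero => simp at hlt; omega
  | succ j ih =>
    by_cases h : ∃ p, p.Prime ∧ p ^ 2 ∣ n
    · obtain ⟨p, hp, m, rfl⟩ := h
      have hm : m ≠ 0 := right_ne_zero_of_mul hn
      have hHp : H ≤ p := hfree p hp.one_lt (Dvd.intro _ rfl)
      have hlt' : m < H ^ j := by
        by_contra! hge
        have h1 : H ≤ p ^ 2 := hHp.trans (Nat.le_self_pow two_ne_zero p)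
        have := Nat.mul_le_mul h1 hge
        rw [pow_succ' H] at hlt
        omega
      have := ih hm hlt' fun d hd hdm => hfree d hd (hdm.mul_left _)
      have h2 := card_sqDivisors_prime_sq_mul_le hp hm
      rw [pow_succ' 2]
      omega
    · push Not at h
      have : sqDivisors n ⊆ {1} := by
        intro d hd
        rw [mem_sqDivisors hn] at hd
        rw [Finset.mem_singleton]
        by_contra hd1
        obtain ⟨p, hp, hpd⟩ := Nat.exists_prime_and_dvd hd1
        exact h p hp ((pow_dvd_pow_of_dvd hpd 2).trans hd)
      calc (sqDivisors n).card ≤ 1 := Finset.card_le_card this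
        _ ≤ 2 ^ (j + 1) := Nat.one_le_two_pow

/-! ### Conflicting coins exclude progressions. -/

/-- The coordinates of a colouring of `ℕ × ℕ` which decide whether `n` is selected. -/
def coins (n : ℕ) : Finset (ℕ × ℕ) :=
  ((sqDivisors n ×ˢ sqDivisors n).filter fun z => 1 < z.2 ∧ z.1 ≤ z.2).image
    fun z => (n * z.2 / z.1, z.2)

theorem mem_coins {n x y m : ℕ} (hn : n ≠ 0) (hx : x ^ 2 ∣ n) (hy : y ^ 2 ∣ n) (hy1 : 1 < y)
    (hxy : x ≤ y) (hm : m * x = n * y) : (m, y) ∈ coins n := by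
  have hx0 : 0 < x := by
    rcases Nat.eq_zero_or_pos x with rfl | h
    · simp at hx; exact absurd hx hn
    · exact h
  refine Finset.mem_image.2 ⟨(x, y), ?_, ?_⟩
  · simp [mem_sqDivisors hn, hx, hy, hy1, hxy]
  · simp [← hm, hx0]

theorem one_lt_and_sq_dvd_of_mem_coins {n : ℕ} {z : ℕ × ℕ} (hz : z ∈ coins n) :
    1 < z.2 ∧ z.2 ^ 2 ∣ n := by
  simp only [coins, sqDivisors, Finset.mem_image, Finset.mem_filter, Finset.mem_product] at hz
  obtain ⟨w, hw, rfl⟩ := hz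
  exact ⟨hw.2.1, hw.1.2.2⟩

theorem card_coins_le {H j n : ℕ} (hn : n ≠ 0) (hlt : n < H ^ j)
    (hfree : ∀ d, 1 < d → d ^ 2 ∣ n → H ≤ d) : (coins n).card ≤ 4 ^ j := by
  have h := card_sqDivisors_le hn hlt hfree
  calc (coins n).card ≤ (sqDivisors n ×ˢ sqDivisors n).card :=
        Finset.card_image_le.trans (Finset.card_filter_le _ _)
    _ = (sqDivisors n).card * (sqDivisors n).card := Finset.card_product _ _
    _ ≤ 2 ^ j * 2 ^ j := Nat.mul_le_mul h h
    _ = 4 ^ j := (mul_pow 2 2 j).symm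

/-- The integers selected by a colouring of `ℕ × ℕ`. -/
def selected (ω : ℕ × ℕ → Bool) : Set ℕ :=
  {n | n ≠ 0 ∧ ∀ z ∈ coins n, ω z = decide (z.1 = n)}

theorem not_forall_mem_selected (ω : ℕ × ℕ → Bool) {x y : ℕ} (hx : 0 < x) (hxy : x < y)
    (hco : x.Coprime y) {a b c d e : ℕ} (h1 : x * b = y * a) (h2 : x * c = y * b)
    (h3 : x * d = y * c) (h4 : x * e = y * d) (hc : c ∈ selected ω) (hd : d ∈ selected ω) :
    False := by
  have hy : 0 < y := hx.trans hxy
  have key : x ^ 4 * e = y ^ 4 * a := by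
    calc x ^ 4 * e = x ^ 3 * (x * e) := by ring
      _ = x ^ 2 * y * (x * d) := by rw [h4]; ring
      _ = x * y ^ 2 * (x * c) := by rw [h3]; ring
      _ = y ^ 3 * (x * b) := by rw [h2]; ring
      _ = y ^ 4 * a := by rw [h1]; ring
  obtain ⟨f, rfl⟩ : x ^ 4 ∣ a :=
    (Nat.Coprime.pow 4 4 hco).dvd_of_dvd_mul_left (key ▸ Dvd.intro _ rfl)
  obtain rfl : b = f * x ^ 3 * y := Nat.eq_of_mul_eq_mul_left hx (by rw [h1]; ring)
  obtain rfl : c = f * x ^ 2 * y ^ 2 := Nat.eq_of_mul_eq_mul_left hx (by rw [h2]; ring)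
  obtain rfl : d = f * x * y ^ 3 := Nat.eq_of_mul_eq_mul_left hx (by rw [h3]; ring)
  have hy1 : 1 < y := by omega
  -- The same coin arises from `c` with the pair `(x, y)` and from `d` with the pair `(y, y)`;
  -- agreement would force `c = d`.
  have hc' := hc.2 (f * x * y ^ 3, y) (mem_coins hc.1 (x := x) (Dvd.intro (f * y ^ 2) (by ring))
    (Dvd.intro (f * x ^ 2) (by ring)) hy1 hxy.le (by ring))
  have hd' := hd.2 (f * x * y ^ 3, y) (mem_coins hd.1 (x := y) (Dvd.intro (f * x * y) (by ring))
    (Dvd.intro (f * x * y) (by ring)) hy1 le_rfl (by ring))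
  rw [hd'] at hc'
  simp only [decide_true, Bool.true_eq, decide_eq_true_eq] at hc'
  have hf : 0 < f * x * y ^ 2 := by
    have := hd.1
    have hf : 0 < f := by
      rcases Nat.eq_zero_or_pos f with rfl | h
      · simp at this
      · exact h
    positivity
  have : f * x * y ^ 2 * y = f * x * y ^ 2 * x := by linarith [hc']
  exact hxy.ne' (Nat.eq_of_mul_eq_mul_left hf this)

theorem gpFree_selected (ω : ℕ × ℕ → Bool) : GPFree 5 (selected ω) := by
  rintro r a ⟨hr, -, hstep⟩ hr1 hall
  choose n hn ha using hall
  have hrat : ∀ i j : Fin 5, (j : ℕ) = (i : ℕ) + 1 → r.den * n j = r.num.natAbs * n i := by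
    intro i j hij
    have h := hstep i j hij
    rw [ha, ha] at h
    have h' : (n j : ℚ) = r * n i := by exact_mod_cast h
    have hnum : ((r.num.natAbs : ℕ) : ℚ) = r.den * r := by
      rw [mul_comm, Rat.mul_den_eq_num, Nat.cast_natAbs, abs_of_pos (Rat.num_pos.2 hr)]
    have : ((r.den * n j : ℕ) : ℚ) = (r.num.natAbs * n i : ℕ) := by
      push_cast
      rw [hnum, h']
      ring
    exact_mod_cast this
  have h1 := hrat 0 1 rfl
  have h2 := hrat 1 2 rfl
  have h3 := hrat 2 3 rfl
  have h4 := hrat 3 4 rfl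
  have hco : r.num.natAbs.Coprime r.den := r.reduced
  have hpos : 0 < r.num.natAbs := Int.natAbs_pos.2 (Rat.num_pos.2 hr).ne'
  rcases lt_trichotomy r.num.natAbs r.den with h | h | h
  -- A decreasing progression is read backwards.
  · exact not_forall_mem_selected ω hpos h hco h4.symm h3.symm h2.symm h1.symm (hn 2) (hn 1)
  · have hd1 : r.den = 1 := by
      rw [h] at hco
      exact (Nat.coprime_self _).1 hco
    apply hr1
    have : r.num = 1 := by
      have := Rat.num_pos.2 hr
      omega
    rw [← Rat.num_div_den r, this, hd1]
    norm_num
  · exact not_forall_mem_selected ω r.den_pos h hco.symm h1 h2 h3 h4 (hn 2) (hn 3)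

/-! ### Sieving short intervals. -/

/-- The integers in `[N, N + H ^ 2)` not divisible by any `d ^ 2` with `2 ≤ d < H`. -/
def sifted (H N : ℕ) : Finset ℕ :=
  (Finset.Ico N (N + H ^ 2)).filter fun n => ∀ d ∈ Finset.Ico 2 H, ¬ d ^ 2 ∣ n

theorem le_of_sq_dvd_of_mem_sifted {H N n d : ℕ} (hn : n ∈ sifted H N) (hd : 1 < d)
    (hdn : d ^ 2 ∣ n) : H ≤ d := by
  by_contra! h
  exact (Finset.mem_filter.1 hn).2 d (Finset.mem_Ico.2 ⟨hd, h⟩) hdn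

theorem ne_zero_of_mem_sifted {H N n : ℕ} (hH : 2 < H) (hn : n ∈ sifted H N) : n ≠ 0 := by
  rintro rfl
  exact absurd (le_of_sq_dvd_of_mem_sifted hn one_lt_two (dvd_zero _)) (by omega)

/-- A shared coin `(m, y)` would give `y ≥ H` with `y ^ 2` dividing two distinct integers less than
`H ^ 2` apart. -/
theorem pairwiseDisjoint_coins_sifted (H N : ℕ) :
    (sifted H N : Set ℕ).PairwiseDisjoint coins := by
  intro a ha b hb hab
  refine Finset.disjoint_left.2 fun z hza hzb => hab ?_
  obtain ⟨h1, ha2⟩ := one_lt_and_sq_dvd_of_mem_coins hza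
  obtain ⟨-, hb2⟩ := one_lt_and_sq_dvd_of_mem_coins hzb
  have hH : H ^ 2 ≤ z.2 ^ 2 := Nat.pow_le_pow_left (le_of_sq_dvd_of_mem_sifted ha h1 ha2) 2
  have hia := Finset.mem_Ico.1 (Finset.mem_filter.1 ha).1
  have hib := Finset.mem_Ico.1 (Finset.mem_filter.1 hb).1
  have hab' : a ≡ b [MOD z.2 ^ 2] :=
    ((Nat.modEq_zero_iff_dvd).2 ha2).trans ((Nat.modEq_zero_iff_dvd).2 hb2).symm
  rcases le_total a b with h | h
  · have := Nat.eq_zero_of_dvd_of_lt ((Nat.modEq_iff_dvd' h).1 hab') (by omega)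
    omega
  · have := Nat.eq_zero_of_dvd_of_lt ((Nat.modEq_iff_dvd' h).1 hab'.symm) (by omega)
    omega

theorem card_Ico_filter_dvd_le (N L : ℕ) {r : ℕ} (hr : 0 < r) :
    (((Finset.Ico N (N + L)).filter (r ∣ ·)).card : ℚ) ≤ L / r + 1 := by
  have h := Nat.Ico_filter_modEq_card N (N + L) hr 0
  simp only [Nat.modEq_zero_iff_dvd, Nat.cast_zero, sub_zero] at h
  have h' : (((Finset.Ico N (N + L)).filter (r ∣ ·)).card : ℚ) =
      max ((⌈((N + L : ℕ) : ℚ) / r⌉ - ⌈(N : ℚ) / r⌉ : ℤ) : ℚ) 0 := by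
    exact_mod_cast congrArg (Int.cast : ℤ → ℚ) h
  rw [h']
  refine max_le ?_ (by positivity)
  have h1 := Int.ceil_lt_add_one (((N + L : ℕ) : ℚ) / r)
  have h2 := Int.le_ceil ((N : ℚ) / r)
  have h3 : ((N + L : ℕ) : ℚ) / r = N / r + L / r := by push_cast; ring
  push_cast at h1 h3 ⊢
  linarith

/-- The term `1/4` is kept exactly; from `d = 3` on, `1/d² ≤ 1/(d-1) - 1/d` telescopes. A total
below `1` is what leaves the sieve a positive proportion. -/
theorem sum_Ico_inv_sq_le (m : ℕ) :
    ∑ d ∈ Finset.Ico 2 (m + 3), (1 : ℚ) / (d : ℚ) ^ 2 ≤ 3 / 4 - 1 / (m + 2) := by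
  induction m with
  | zero => norm_num [Finset.sum_Ico_eq_sum_range]
  | succ m ih =>
    rw [Finset.sum_Ico_succ_top (by omega)]
    have : (1 : ℚ) / ((m + 3 : ℕ) : ℚ) ^ 2 ≤ 1 / (m + 2) - 1 / (m + 3) := by
      push_cast
      rw [div_sub_div _ _ (by positivity) (by positivity),
        div_le_div_iff₀ (by positivity) (by positivity)]
      have : (0 : ℚ) ≤ m := m.cast_nonneg
      nlinarith
    push_cast at this ih ⊢
    have e : (m : ℚ) + 1 + 2 = m + 3 := by ring
    rw [e]
    linarith

theorem le_card_sifted {H : ℕ} (hH : 8 ≤ H) (N : ℕ) : H ≤ (sifted H N).card := by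
  set I := Finset.Ico N (N + H ^ 2) with hI
  have hsplit := Finset.card_filter_add_card_filter_not (s := I)
    fun n => ∀ d ∈ Finset.Ico 2 H, ¬ d ^ 2 ∣ n
  have hbad : ((I.filter fun n => ¬ ∀ d ∈ Finset.Ico 2 H, ¬ d ^ 2 ∣ n).card : ℚ) ≤
      3 / 4 * H ^ 2 + H := by
    have hsub : (I.filter fun n => ¬ ∀ d ∈ Finset.Ico 2 H, ¬ d ^ 2 ∣ n) ⊆
        (Finset.Ico 2 H).biUnion fun d => I.filter (d ^ 2 ∣ ·) := by
      intro n hn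
      simp only [Finset.mem_filter, not_forall, not_not] at hn
      obtain ⟨hnI, d, hd, hdn⟩ := hn
      exact Finset.mem_biUnion.2 ⟨d, hd, Finset.mem_filter.2 ⟨hnI, hdn⟩⟩
    obtain ⟨m, rfl⟩ : ∃ m, H = m + 3 := ⟨H - 3, by omega⟩
    calc ((I.filter fun n => ¬ ∀ d ∈ Finset.Ico 2 (m + 3), ¬ d ^ 2 ∣ n).card : ℚ)
        ≤ ∑ d ∈ Finset.Ico 2 (m + 3), ((I.filter (d ^ 2 ∣ ·)).card : ℚ) := by
          exact_mod_cast (Finset.card_le_card hsub).trans Finset.card_biUnion_le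
      _ ≤ ∑ d ∈ Finset.Ico 2 (m + 3), (((m + 3 : ℕ) : ℚ) ^ 2 * (1 / (d : ℚ) ^ 2) + 1) := by
          refine Finset.sum_le_sum fun d hd => ?_
          have hd2 : 0 < d ^ 2 := pow_pos (by have := (Finset.mem_Ico.1 hd).1; omega) 2
          have := card_Ico_filter_dvd_le N ((m + 3) ^ 2) hd2
          rw [mul_one_div]
          exact_mod_cast this
      _ = ((m + 3 : ℕ) : ℚ) ^ 2 * ∑ d ∈ Finset.Ico 2 (m + 3), (1 : ℚ) / (d : ℚ) ^ 2 +
            (m + 1 : ℕ) := by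
          rw [Finset.sum_add_distrib, Finset.mul_sum]
          simp
      _ ≤ ((m + 3 : ℕ) : ℚ) ^ 2 * (3 / 4) + (m + 3 : ℕ) := by
          have h1 := sum_Ico_inv_sq_le m
          have h2 : (0 : ℚ) ≤ 1 / (m + 2) := by positivity
          gcongr
          · linarith
          · omega
      _ = _ := by ring
  have hcard : I.card = H ^ 2 := by simp [hI]
  rw [hcard] at hsplit
  have hsplit' : ((sifted H N).card : ℚ) +
      ((I.filter fun n => ¬ ∀ d ∈ Finset.Ico 2 H, ¬ d ^ 2 ∣ n).card : ℚ) = H ^ 2 := by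
    exact_mod_cast hsplit
  have hH' : (8 : ℚ) ≤ H := by exact_mod_cast hH
  -- `H²/4 - H ≥ H` is where `8 ≤ H` enters.
  have : (H : ℚ) ≤ (sifted H N).card := by nlinarith
  exact_mod_cast this

theorem card_coins_le_of_mem_sifted {H N n k : ℕ} (hH : 2 < H) (hN : N < H ^ k)
    (hn : n ∈ sifted H N) : (coins n).card ≤ 4 ^ (k + 3) := by
  refine card_coins_le (H := H) (ne_zero_of_mem_sifted hH hn) ?_
    fun d hd hdn => le_of_sq_dvd_of_mem_sifted hn hd hdn
  have h1 := (Finset.mem_Ico.1 (Finset.mem_filter.1 hn).1).2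
  have h2 : H ^ k ≤ H ^ (k + 2) := Nat.pow_le_pow_right (by omega) (by omega)
  have h3 : H ^ 2 ≤ H ^ (k + 2) := Nat.pow_le_pow_right (by omega) (by omega)
  calc n < 2 * H ^ (k + 2) := by omega
    _ ≤ H * H ^ (k + 2) := Nat.mul_le_mul_right _ (by omega)
    _ = H ^ (k + 3) := by ring

/-! ### Union bound and gap estimate. -/

theorem exists_tail_lt (k D : ℕ) {δ : ENNReal} (hδ : 0 < δ) :
    ∃ H₀, 8 ≤ H₀ ∧
      ∑' i : ℕ, ((i + H₀ : ℕ) : ENNReal) ^ k * (1 - 2⁻¹ ^ D) ^ (i + H₀) < δ := by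
  have hq0 : (0 : ℝ) ≤ 1 - 2⁻¹ ^ D := sub_nonneg.2 (pow_le_one₀ (by norm_num) (by norm_num))
  have hq1 : (1 : ℝ) - 2⁻¹ ^ D < 1 := sub_lt_self _ (by positivity)
  have hs : Summable fun n : ℕ => (n : ℝ) ^ k * (1 - 2⁻¹ ^ D) ^ n :=
    summable_pow_mul_geometric_of_norm_lt_one k (by rwa [Real.norm_of_nonneg hq0])
  have hterm : ∀ n : ℕ, ENNReal.ofReal ((n : ℝ) ^ k * (1 - 2⁻¹ ^ D) ^ n) =
      (n : ENNReal) ^ k * (1 - 2⁻¹ ^ D) ^ n := by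
    intro n
    rw [ENNReal.ofReal_mul (by positivity), ENNReal.ofReal_pow (by positivity),
      ENNReal.ofReal_pow hq0, ENNReal.ofReal_natCast, ENNReal.ofReal_sub _ (by positivity),
      ENNReal.ofReal_one, ENNReal.ofReal_pow (by norm_num), ENNReal.ofReal_inv_of_pos two_pos,
      ENNReal.ofReal_ofNat]
  have ht := ENNReal.tendsto_sum_nat_add _ hs.tsum_ofReal_ne_top
  simp only [hterm] at ht
  obtain ⟨H₀, h1, h2⟩ := ((ht.eventually (gt_mem_nhds hδ)).and
    (Filter.eventually_ge_atTop 8)).exists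
  exact ⟨H₀, h2, h1⟩

theorem exists_selected_mem_intervals :
    ∃ ω, ∀ k, ∃ H₀, ∀ H ≥ H₀, ∀ N < H ^ k, ∃ n ∈ selected ω, N ≤ n ∧ n < N + H ^ 2 := by
  obtain ⟨δ, hδ, hδsum⟩ := ENNReal.exists_pos_sum_of_countable' one_ne_zero ℕ
  choose H₀ h8 htail using fun k => exists_tail_lt k (4 ^ (k + 3)) (hδ k)
  obtain ⟨ω, hω⟩ := exists_forall_exists_agree
    (J := Σ k : ℕ, Σ i : ℕ, Fin ((i + H₀ k) ^ k))
    (fun j => sifted (j.2.1 + H₀ j.1) j.2.2) coins (fun n z => decide (z.1 = n))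
    (fun j => 4 ^ (j.1 + 3)) (fun j => j.2.1 + H₀ j.1)
    (fun j n hn => card_coins_le_of_mem_sifted (by have := h8 j.1; omega) j.2.2.2 hn)
    (fun j => pairwiseDisjoint_coins_sifted _ _)
    (fun j => le_card_sifted (by have := h8 j.1; omega) _) (by
      refine lt_of_le_of_lt ?_ hδsum
      rw [ENNReal.tsum_sigma']
      refine ENNReal.tsum_le_tsum fun k => ?_
      rw [ENNReal.tsum_sigma']
      refine le_trans (le_of_eq ?_) (htail k).le
      congr 1
      ext i
      simp [tsum_fintype])
  refine ⟨ω, fun k => ⟨H₀ k, fun H hH N hN => ?_⟩⟩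
  obtain ⟨i, rfl⟩ := Nat.exists_eq_add_of_le' hH
  obtain ⟨n, hn, hagree⟩ := hω ⟨k, i, N, hN⟩
  have h8' := h8 k
  have hI := Finset.mem_Ico.1 (Finset.mem_filter.1 hn).1
  exact ⟨n, ⟨ne_zero_of_mem_sifted (by dsimp; omega) hn, hagree⟩, hI⟩

theorem mainTheorem3 :
    ∃ t : ℕ → ℕ, StrictMono t ∧ (∀ i, 0 < t i) ∧ GPFree 5 (Set.range t) ∧
      ∀ ε : ℝ, 0 < ε → ∃ C : ℝ, 0 < C ∧
        ∀ i : ℕ, (t (i + 1) : ℝ) - (t i : ℝ) < C * (t i : ℝ) ^ ε := by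
  obtain ⟨ω, hω⟩ := exists_selected_mem_intervals
  have hinf : (Set.ofPred fun n => n ∈ selected ω).Infinite := by
    refine Set.infinite_of_forall_exists_gt fun M => ?_
    obtain ⟨H₀, h⟩ := hω 1
    obtain ⟨n, hn, hMn, -⟩ := h (H₀ + M + 2) (by omega) (M + 1) (by rw [pow_one]; omega)
    exact ⟨n, hn, hMn⟩
  have hmono : StrictMono (Nat.nth fun n => n ∈ selected ω) := Nat.nth_strictMono hinf
  have hrange : Set.range (Nat.nth fun n => n ∈ selected ω) = selected ω :=
    Nat.range_nth_of_infinite hinf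
  set t := Nat.nth fun n => n ∈ selected ω
  have hpos : ∀ i, 0 < t i := fun i => by
    have : t i ∈ selected ω := hrange ▸ Set.mem_range_self i
    exact Nat.pos_of_ne_zero this.1
  refine ⟨t, hmono, hpos, hrange ▸ gpFree_selected ω, fun ε hε => ?_⟩
  set k := ⌈2 / ε⌉₊ with hk
  have hkpos : 0 < k := Nat.ceil_pos.2 (by positivity)
  have hk' : (0 : ℝ) < k := by exact_mod_cast hkpos
  have hkε : 2 / (k : ℝ) ≤ ε := by
    rw [div_le_iff₀ hk', mul_comm, ← div_le_iff₀ hε]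
    exact Nat.le_ceil _
  obtain ⟨H₀, hH₀⟩ := hω k
  -- With `s = t i ^ (1/k)`, `H ≤ (H₀ + 4) * s` bounds the gap; the `+ 1` makes it strict.
  refine ⟨(H₀ + 4) ^ 2 + 1, by positivity, fun i => ?_⟩
  have ht1 : (1 : ℝ) ≤ t i := by exact_mod_cast hpos i
  set s : ℝ := (t i : ℝ) ^ (1 / (k : ℝ)) with hs
  have hs1 : 1 ≤ s := Real.one_le_rpow ht1 (by positivity)
  have hsk : s ^ k = t i := by
    rw [hs, one_div, Real.rpow_inv_natCast_pow (by positivity) hkpos.ne']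
  have hs2 : s ^ 2 ≤ (t i : ℝ) ^ ε := by
    rw [hs, ← Real.rpow_natCast, ← Real.rpow_mul (by positivity)]
    refine Real.rpow_le_rpow_of_exponent_le ht1 ?_
    rw [one_div_mul_eq_div]
    exact_mod_cast hkε
  -- The factor `3` gives `H ^ k ≥ 3 * t i > t i + 1`.
  set H := H₀ + ⌈3 * s⌉₊ with hH
  have hHs : 3 * s ≤ H := by
    have := Nat.le_ceil (3 * s)
    rw [hH]
    push_cast
    linarith [(H₀.cast_nonneg : (0 : ℝ) ≤ H₀)]
  have hHle : (H : ℝ) ≤ (H₀ + 4) * s := by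
    have h1 := Nat.ceil_lt_add_one (show 0 ≤ 3 * s by positivity)
    have h2 : (H₀ : ℝ) ≤ H₀ * s := le_mul_of_one_le_right (by positivity) hs1
    rw [hH]
    push_cast
    linarith
  have hN : t i + 1 < H ^ k := by
    have h1 : (3 * s) ^ k ≤ (H : ℝ) ^ k := pow_le_pow_left₀ (by positivity) hHs k
    have h2 : (3 : ℝ) ≤ 3 ^ k := le_self_pow₀ (by norm_num) hkpos.ne'
    rw [mul_pow, hsk] at h1
    have h3 : (t i : ℝ) + 1 < (H : ℝ) ^ k := by nlinarith
    exact_mod_cast h3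
  obtain ⟨n, hn, hle, hlt⟩ := hH₀ H (by omega) (t i + 1) hN
  obtain ⟨j, rfl⟩ : n ∈ Set.range t := hrange.symm ▸ hn
  have hij : i < j := hmono.lt_iff_lt.1 hle
  have hgap : t (i + 1) ≤ t i + H ^ 2 := by
    have := hmono.monotone (Nat.succ_le_of_lt hij)
    simp only [Nat.succ_eq_add_one] at this
    omega
  have hgap' : (t (i + 1) : ℝ) ≤ t i + (H : ℝ) ^ 2 := by exact_mod_cast hgap
  have hsq : (H : ℝ) ^ 2 ≤ ((H₀ + 4) * s) ^ 2 := pow_le_pow_left₀ (by positivity) hHle 2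
  have hpow : (0 : ℝ) < (t i : ℝ) ^ ε := Real.rpow_pos_of_pos (by linarith) _
  have : ((H₀ + 4) * s) ^ 2 ≤ ((H₀ : ℝ) + 4) ^ 2 * (t i : ℝ) ^ ε := by
    rw [mul_pow]
    gcongr
  linarith
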